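/- Let $d\ge 0$ be an integer and let $A\subseteq\mathbb Z^d$ be a finite set. Put $$\Omega(A)=\{\omega\in A^{\mathbb Z^d} : n\mapsto n+\omega(n)\text{ is a permutation of }\mathbb Z^d\},$$ with the topology inherited from the product topology on $A^{\mathbb Z^d}$ ($A$ discrete) and with the shift action $(\sigma_m\omega)(n)=\omega(n+m)$ of $\mathbb Z^d$. For $n\in\mathbb N^d$ let $[n]=\prod_{i=1}^d\{0,\dots,n_i-1\}$, and let $B_n(\Omega(A))$ be the set of restrictions to $[n]$ of elements of $\Omega(A)$. The topological entropy is $$h(\Omega(A))=\limsup_{n\to\infty}\frac{\log|B_n(\Omega(A))|}{|[n]|}\in[-\infty,\infty],$$ where $n\to\infty$ means that all coordinates of $n$ tend to infinity, and $\log 0=-\infty$. Then: 1. For every injective affine map $T:\mathbb Z^d\to\mathbb Z^d$ (that is, $Tx=Mx+b$ with $b\in\mathbb Z^d$ and $M$ an integer $d\times d$ matrix that is invertible over $\mathbb R$), $$h(\Omega(T(A)))=h(\Omega(A)).$$ 2. For every injective group endomorphism $M$ of $\mathbb Z^d$, the subgroup $M\mathbb Z^d$ has finite index $k=[\mathbb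 Z^d:M\mathbb Z^d]$, and $\Omega(MA)$ with the shift action of $M\mathbb Z^d$ is topologically conjugate to $\Omega(A)^k$ with the diagonal shift action of $\mathbb Z^d$, the groups being identified through $M$: there is a homeomorphism $\Phi:\Omega(MA)\to\Omega(A)^k$ with $\Phi(\sigma_{Mn}\,\omega)=(\sigma_n\omega_1,\dots,\sigma_n\omega_k)$ for all $n\in\mathbb Z^d$ and $\omega\in\Omega(MA)$, where $(\omega_1,\dots,\omega_k)=\Phi(\omega)$. -/

import Mathlib

namespace RestrictedPerm

open Filter

/-- `Ω(A)`: configurations `ω ∈ A^{ℤ^d}` such that `n ↦ n + ω(n)` is a permutation of `ℤ^d`.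
The topology on `ℤ^d → A` is the product topology, `A` being discrete as a subspace of `ℤ^d`. -/
def Omega {d : ℕ} (A : Finset (Fin d → ℤ)) : Set ((Fin d → ℤ) → A) :=
  {ω | Function.Bijective fun n : Fin d → ℤ => n + (ω n : Fin d → ℤ)}

/-- The shift action of `ℤ^d` on configurations: `m` sends `ω` to `n ↦ ω (n + m)`. -/
def shift {d : ℕ} {S : Type*} (m : Fin d → ℤ) (ω : (Fin d → ℤ) → S) : (Fin d → ℤ) → S :=
  fun n => ω (n + m)

theorem shift_mem_Omega {d : ℕ} {A : Finset (Fin d → ℤ)} (m : Fin d → ℤ)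
    {ω : (Fin d → ℤ) → A} (hω : ω ∈ Omega A) : shift m ω ∈ Omega A := by
  have h : (fun n : Fin d → ℤ => n + ((shift m ω n : A) : Fin d → ℤ)) =
      (Equiv.subRight m) ∘ (fun n => n + (ω n : Fin d → ℤ)) ∘ (Equiv.addRight m) := by
    funext n
    simp only [shift, Function.comp_apply, Equiv.coe_addRight, Equiv.subRight_apply]
    abel
  change Function.Bijective _
  rw [h]
  exact (Equiv.bijective _).comp (Function.Bijective.comp hω (Equiv.bijective _))

/-- The shift action of `ℤ^d` restricted to the invariant set `Ω(A)`. -/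
def shiftOmega {d : ℕ} {A : Finset (Fin d → ℤ)} (m : Fin d → ℤ) (ω : Omega A) : Omega A :=
  ⟨shift m ω.1, shift_mem_Omega m ω.2⟩

/-- The box `[n] = [n₁] × ⋯ × [n_d]`, where `[k] = {0, …, k - 1}`. -/
noncomputable def box {d : ℕ} (n : Fin d → ℕ) : Finset (Fin d → ℤ) :=
  Fintype.piFinset fun i => Finset.Ico (0 : ℤ) (n i)

/-- `B_n(X)`: the patterns on the box `[n]` that occur in elements of `X`. -/
def patterns {d : ℕ} {S : Type*} (X : Set ((Fin d → ℤ) → S)) (n : Fin d → ℕ) :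
    Set (box n → S) :=
  {P | ∃ ω ∈ X, ∀ m : box n, ω m = P m}

/-- The topological entropy `limsup_{n → ∞} log |B_n(X)| / |[n]|` of `X ⊆ S^{ℤ^d}` under the
shifts, where `n → ∞` means that every coordinate of `n ∈ ℕ^d` tends to infinity. It lives in
the extended reals, with `log 0 = -∞`; so the entropy of the empty set is `-∞`. -/
noncomputable def topEntropy {d : ℕ} {S : Type*} (X : Set ((Fin d → ℤ) → S)) : EReal :=
  limsup (fun n : Fin d → ℕ =>
    ENNReal.log ((patterns X n).encard : ENNReal) / (((box n).card : ℕ) : EReal)) atTop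

end RestrictedPerm

/-!
Let `f x = M x + b` with `M` an injective endomorphism of `ℤ^d`, and let `r i` represent the `k`
cosets of `M ℤ^d`. If `ω` takes values in `f(A)`, then `n ↦ n + ω n` maps `r i + M q` to
`b + r i + M (q + ω_i q)`, where `ω_i q = f⁻¹ (ω (r i + M q))`. Hence `ω` lies in `Ω(f(A))` if and
only if every `ω_i` lies in `Ω(A)` (`mem_Omega_image_iff`), which gives the conjugacy
`OmegaImageHomeomorph`. For `F ⊆ ℤ^d` finite it also shows that the number of patterns of `Ω(f(A))`
on `⋃ i, (r i + M F)` is the `k`-th power of the number of patterns of `Ω(A)` on `F`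
(`patternCount_Omega_image`).

The entropy of a shift invariant set is at most `log p / |S|`, if `p` is the number of its patterns
on a finite set `S` whose translates tile `ℤ^d`: the tiles that meet a large box fill a box that is
only slightly larger (`topEntropy_le_of_tiling`). For `S = ⋃ i, (r i + M [m])` the bound
is `log |B_m(Ω(A))| / |[m]|`, so `h(Ω(f(A))) ≤ h(Ω(A))` (`topEntropy_Omega_image_le`).

No geometric argument is needed for the reverse inequality. The group endomorphism `N = k M⁻¹`
maps `ℤ^d` to itself, since `k ℤ^d ⊆ M ℤ^d`, and `N ∘ f` is a homothety `g` with ratio `k`. As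
`[k n]` is a union of translates of `k [n]` by coset representatives, the patterns of `Ω(g(A))` on
the boxes `[k n]` show `h(Ω(A)) ≤ h(Ω(g(A)))` (`topEntropy_Omega_le_homothety`), and the inequality
already proved, for `N` and `f(A)`, gives `h(Ω(g(A))) ≤ h(Ω(f(A)))`.
-/

namespace RestrictedPerm

open Filter

/-! ### Counting patterns along a finite family of sites -/

/-- The patterns that elements of `X` show along a family `s` of sites of `ℤ^d`. For the inclusion
of a box this is `patterns X n`. -/
def patternsAlong {d : ℕ} {S J : Type*} (X : Set ((Fin d → ℤ) → S)) (s : J → Fin d → ℤ) :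
    Set (J → S) :=
  {P | ∃ ω ∈ X, ∀ j, ω (s j) = P j}

/-- The number of patterns along the family `s` (only used when there are finitely many). -/
noncomputable def patternCount {d : ℕ} {S J : Type*} (X : Set ((Fin d → ℤ) → S))
    (s : J → Fin d → ℤ) : ℕ :=
  Nat.card (patternsAlong X s)

theorem patternCount_pos {d : ℕ} {S J : Type*} [Finite S] [Finite J]
    {X : Set ((Fin d → ℤ) → S)} (hX : X.Nonempty) (s : J → Fin d → ℤ) :
    0 < patternCount X s := by
  obtain ⟨ω, hω⟩ := hX
  have : Nonempty (patternsAlong X s) := ⟨⟨fun j => ω (s j), ω, hω, fun _ => rfl⟩⟩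
  exact Nat.card_pos

/-- If finitely many translates of `s` cover `u`, a pattern along `u` is determined by the patterns
along those translates. -/
theorem patternCount_le_pow {d : ℕ} {S J K T : Type*} [Finite S] [Finite J] [Fintype T]
    {X : Set ((Fin d → ℤ) → S)} (hX : ∀ m, ∀ ω ∈ X, shift m ω ∈ X)
    (s : J → Fin d → ℤ) (u : K → Fin d → ℤ) (h : T → Fin d → ℤ)
    (hcov : ∀ k, ∃ t j, u k = h t + s j) :
    patternCount X u ≤ patternCount X s ^ Fintype.card T := by
  have hchoice : ∀ P : patternsAlong X u, ∃ ω ∈ X, ∀ k, ω (u k) = P.1 k := fun P => P.2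
  choose w hwX hw using hchoice
  rw [patternCount, patternCount, ← Nat.card_eq_fintype_card, ← Nat.card_fun]
  refine Nat.card_le_card_of_injective
    (fun P t => ⟨fun j => w P (h t + s j), shift (h t) (w P), hX _ _ (hwX P), fun j => ?_⟩) ?_
  · simp only [shift, add_comm]
  · intro P Q hPQ
    ext k
    obtain ⟨t, j, hk⟩ := hcov k
    have := congrFun (congrArg Subtype.val (congrFun hPQ t)) j
    rw [← hw P, ← hw Q, hk]
    exact this

theorem shift_invariant_Omega {d : ℕ} (A : Finset (Fin d → ℤ)) (m : Fin d → ℤ) :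
    ∀ ω ∈ Omega A, shift m ω ∈ Omega A :=
  fun _ hω => shift_mem_Omega m hω

/-! ### Boxes and the entropy as a limit of real numbers -/

theorem card_box {d : ℕ} (n : Fin d → ℕ) : (box n).card = ∏ i, n i := by
  simp [box]

theorem mem_box {d : ℕ} {n : Fin d → ℕ} {x : Fin d → ℤ} :
    x ∈ box n ↔ ∀ i, 0 ≤ x i ∧ x i < n i := by
  simp [box]

theorem tendsto_eval_atTop_nat {d : ℕ} (i : Fin d) :
    Tendsto (fun n : Fin d → ℕ => n i) atTop atTop :=
  tendsto_atTop_atTop.2 fun b => ⟨fun _ => b, fun _ ha => ha i⟩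

theorem eventually_forall_pos (d : ℕ) : ∀ᶠ n : Fin d → ℕ in atTop, ∀ i, 0 < n i := by
  filter_upwards [eventually_ge_atTop (fun _ : Fin d => 1)] with n hn i
  exact hn i

theorem topEntropy_eq_bot_of_empty {d : ℕ} {S : Type*} {X : Set ((Fin d → ℤ) → S)}
    (hX : X = ∅) : topEntropy X = ⊥ := by
  have h : ∀ᶠ n : Fin d → ℕ in atTop,
      ENNReal.log ((patterns X n).encard : ENNReal) / (((box n).card : ℕ) : EReal) = ⊥ := by
    filter_upwards [eventually_forall_pos d] with n hn
    have hp : patterns X n = ∅ := by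
      ext P
      simp [patterns, hX]
    have hpos : 0 < (box n).card := by
      rw [card_box]
      exact Finset.prod_pos fun i _ => hn i
    rw [hp, Set.encard_empty]
    simp only [ENat.toENNReal_zero, ENNReal.log_zero]
    exact EReal.bot_div_of_pos_ne_top (by exact_mod_cast hpos) (EReal.natCast_ne_top _)
  rw [topEntropy, limsup_congr h, limsup_const]

theorem entropy_ratio_eq_coe {d : ℕ} {S : Type*} [Finite S] {X : Set ((Fin d → ℤ) → S)}
    (hX : X.Nonempty) (n : Fin d → ℕ) :
    ENNReal.log ((patterns X n).encard : ENNReal) / (((box n).card : ℕ) : EReal) =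
      ((Real.log (patternCount X (Subtype.val : box n → Fin d → ℤ)) / (box n).card : ℝ) :
        EReal) := by
  have hpos := patternCount_pos hX (Subtype.val : box n → Fin d → ℤ)
  have h : (patterns X n).encard =
      ((patternCount X (Subtype.val : box n → Fin d → ℤ) : ℕ) : ℕ∞) :=
    ((Set.toFinite (patterns X n)).cast_ncard_eq).symm
  rw [h, ENat.toENNReal_coe,
    ENNReal.log_pos_real (by exact_mod_cast hpos.ne') (ENNReal.natCast_ne_top _),
    ENNReal.toReal_natCast, EReal.coe_div, EReal.coe_coe_eq_natCast]

/-- Enlarging all sides of a box by a constant does not change its volume asymptotically. -/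
theorem tendsto_prod_add_div (d K : ℕ) :
    Tendsto (fun n : Fin d → ℕ => ∏ i, (((n i : ℝ) + K) / n i)) atTop (nhds 1) := by
  have h1 : Tendsto (fun k : ℕ => ((k : ℝ) + K) / k) atTop (nhds 1) := by
    have h0 : Tendsto (fun k : ℕ => 1 + (K : ℝ) / k) atTop (nhds (1 + 0)) :=
      tendsto_const_nhds.add (tendsto_const_div_atTop_nhds_zero_nat _)
    rw [add_zero] at h0
    refine h0.congr' ?_
    filter_upwards [eventually_gt_atTop 0] with k hk
    have : (k : ℝ) ≠ 0 := by exact_mod_cast hk.ne'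
    field_simp
  simpa using tendsto_finsetProd Finset.univ
    fun i _ => h1.comp (tendsto_eval_atTop_nat i)

/-! ### An upper bound for the entropy from a tiling -/

/-- If translates of the finite family `s` tile `ℤ^d`, the tiles meeting a box lie in a slightly
larger box, so their number is at most the volume of that box divided by the size of a tile. -/
theorem exists_cover_box {d : ℕ} {J τ : Type*} [Fintype J] {s : J → Fin d → ℤ}
    {h : τ → Fin d → ℤ} (hE : Function.Bijective fun p : τ × J => h p.1 + s p.2) :
    ∃ K : ℕ, ∀ n : Fin d → ℕ, ∃ T : Finset τ,
      (∀ x ∈ box n, ∃ t ∈ T, ∃ j, x = h t + s j) ∧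
        T.card * Fintype.card J ≤ ∏ i, (n i + K) := by
  classical
  obtain ⟨D, hD⟩ : ∃ D : ℕ, ∀ j i, |s j i| ≤ D := by
    refine ⟨∑ j, ∑ i, (s j i).natAbs, fun j i => ?_⟩
    rw [Int.abs_eq_natAbs]
    have h1 := Finset.single_le_sum (f := fun i => (s j i).natAbs) (fun _ _ => Nat.zero_le _)
      (Finset.mem_univ i)
    have h2 := Finset.single_le_sum (f := fun j => ∑ i, (s j i).natAbs)
      (fun _ _ => Nat.zero_le _) (Finset.mem_univ j)
    exact_mod_cast h1.trans h2
  choose g hg using hE.2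
  -- Two sites of one tile differ by at most `2 * D` in each coordinate, on either side of the box.
  refine ⟨4 * D, fun n => ⟨(box n).image fun x => (g x).1, fun x hx => ?_, ?_⟩⟩
  · exact ⟨(g x).1, Finset.mem_image_of_mem _ hx, (g x).2, (hg x).symm⟩
  · have hcard : (Fintype.piFinset fun i => Finset.Ico (-(2 * D : ℤ)) (n i + 2 * D)).card =
        ∏ i, (n i + 4 * D) := by
      rw [Fintype.card_piFinset]
      refine Finset.prod_congr rfl fun i _ => ?_
      rw [Int.card_Ico]
      omega
    rw [← hcard, ← Finset.card_univ, ← Finset.card_product]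
    refine Finset.card_le_card_of_injOn (fun p => h p.1 + s p.2) ?_ hE.1.injOn
    rintro ⟨t, j⟩ htj
    obtain ⟨x, hx, rfl⟩ := Finset.mem_image.1 (Finset.mem_product.1 htj).1
    simp only [Finset.mem_coe, Fintype.mem_piFinset, Finset.mem_Ico, Pi.add_apply]
    intro i
    have h1 := congrFun (hg x) i
    simp only [Pi.add_apply] at h1
    have h2 := mem_box.1 hx i
    have h3 := abs_le.1 (hD j i)
    have h4 := abs_le.1 (hD (g x).2 i)
    omega

theorem topEntropy_le_of_tiling {d : ℕ} {S J τ : Type*} [Finite S] [Fintype J] [Nonempty J]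
    {X : Set ((Fin d → ℤ) → S)} (hX : ∀ m, ∀ ω ∈ X, shift m ω ∈ X)
    {s : J → Fin d → ℤ} {h : τ → Fin d → ℤ}
    (hE : Function.Bijective fun p : τ × J => h p.1 + s p.2) :
    topEntropy X ≤ ((Real.log (patternCount X s) / Fintype.card J : ℝ) : EReal) := by
  rcases X.eq_empty_or_nonempty with hemp | hne
  · rw [topEntropy_eq_bot_of_empty hemp]
    exact bot_le
  obtain ⟨K, hK⟩ := exists_cover_box hE
  set c : ℝ := Real.log (patternCount X s) / Fintype.card J with hc
  have hlim : Tendsto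
      (fun n : Fin d → ℕ => ((c * ∏ i, (((n i : ℝ) + K) / n i) : ℝ) : EReal)) atTop
      (nhds (c : EReal)) := by
    have := (tendsto_prod_add_div d K).const_mul c
    rw [mul_one] at this
    exact (continuous_coe_real_ereal.tendsto c).comp this
  rw [← hlim.limsup_eq, topEntropy]
  refine limsup_le_limsup ?_
  filter_upwards [eventually_forall_pos d] with n hn
  rw [entropy_ratio_eq_coe hne, EReal.coe_le_coe_iff]
  obtain ⟨T, hcov, hT⟩ := hK n
  have hJ : (0 : ℝ) < Fintype.card J := by exact_mod_cast Fintype.card_pos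
  have hbox : (0 : ℝ) < (box n).card := by
    rw [card_box]
    exact_mod_cast Finset.prod_pos fun i _ => hn i
  have hlog0 : 0 ≤ Real.log (patternCount X s) := Real.log_natCast_nonneg _
  have h1 : Real.log (patternCount X (Subtype.val : box n → Fin d → ℤ)) ≤
      T.card * Real.log (patternCount X s) := by
    have h2 := patternCount_le_pow hX s (Subtype.val : box n → Fin d → ℤ)
      (fun t : T => h t.1) fun k => by
        obtain ⟨t, ht, j, hj⟩ := hcov k.1 k.2
        exact ⟨⟨t, ht⟩, j, hj⟩
    rw [Fintype.card_coe] at h2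
    rw [← Real.log_pow]
    exact Real.log_le_log (by exact_mod_cast patternCount_pos hne _) (by exact_mod_cast h2)
  have hT' : (T.card : ℝ) * Fintype.card J ≤ ∏ i, ((n i : ℝ) + K) := by exact_mod_cast hT
  have hprod : ((box n).card : ℝ) = ∏ i, (n i : ℝ) := by
    rw [card_box]
    push_cast
    rfl
  rw [Finset.prod_div_distrib, ← hprod, hc, div_mul_div_comm, div_le_div_iff₀ hbox (by positivity)]
  calc _ ≤ (T.card * Real.log (patternCount X s)) * (Fintype.card J * (box n).card) := by gcongr
    _ = (Real.log (patternCount X s) * (box n).card) * (T.card * Fintype.card J) := by ring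
    _ ≤ (Real.log (patternCount X s) * (box n).card) * ∏ i, ((n i : ℝ) + K) := by gcongr
    _ = _ := by ring

/-! ### Splitting a configuration along cosets -/

/-- The bijection of `A` with its image under an injective map. -/
noncomputable def imageEquiv {α : Type*} [DecidableEq α] (A : Finset α) (f : α → α)
    (hf : Function.Injective f) : A ≃ A.image f :=
  Equiv.ofBijective (fun a => ⟨f a, Finset.mem_image_of_mem f a.2⟩)
    ⟨fun a b hab => Subtype.ext (hf (congrArg Subtype.val hab)), fun y => by
      obtain ⟨x, hx, hxy⟩ := Finset.mem_image.1 y.2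
      exact ⟨⟨x, hx⟩, Subtype.ext hxy⟩⟩

theorem imageEquiv_coe {α : Type*} [DecidableEq α] (A : Finset α) (f : α → α)
    (hf : Function.Injective f) (a : A) : (imageEquiv A f hf a : α) = f a :=
  rfl

theorem injective_of_forall_eq_add {d : ℕ} {M : (Fin d → ℤ) →+ (Fin d → ℤ)}
    (hM : Function.Injective M) {f : (Fin d → ℤ) → (Fin d → ℤ)} {b : Fin d → ℤ}
    (hf : ∀ x, f x = M x + b) : Function.Injective f := by
  intro x y hxy
  rw [hf, hf] at hxy
  exact hM (add_right_cancel hxy)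

/-- Given representatives `r i` of the cosets of the range of `M`, a configuration with values in
`f(A)` splits into the configurations `q ↦ f⁻¹ (ω (r i + M q))` with values in `A`. -/
noncomputable def cosetSplit {d : ℕ} {ι : Type*} (A : Finset (Fin d → ℤ))
    (M : (Fin d → ℤ) →+ (Fin d → ℤ)) {f : (Fin d → ℤ) → (Fin d → ℤ)}
    (hf : Function.Injective f) {r : ι → Fin d → ℤ}
    (hr : Function.Bijective fun p : ι × (Fin d → ℤ) => r p.1 + M p.2) :
    ((Fin d → ℤ) → A.image f) ≃ (ι → (Fin d → ℤ) → A) where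
  toFun ω i q := (imageEquiv A f hf).symm (ω (r i + M q))
  invFun w x :=
    imageEquiv A f hf
      (w ((Equiv.ofBijective _ hr).symm x).1 ((Equiv.ofBijective _ hr).symm x).2)
  left_inv ω := by
    funext x
    have h : r ((Equiv.ofBijective _ hr).symm x).1 + M ((Equiv.ofBijective _ hr).symm x).2 = x :=
      (Equiv.ofBijective _ hr).apply_symm_apply x
    simp only [h, Equiv.apply_symm_apply]
  right_inv w := by
    funext i q
    have h : (Equiv.ofBijective _ hr).symm (r i + M q) = (i, q) :=
      (Equiv.ofBijective _ hr).symm_apply_apply (i, q)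
    simp only [h, Equiv.symm_apply_apply]

theorem bijective_prod_fiberwise_iff {ι α : Type*} (g : ι → α → α) :
    (Function.Bijective fun p : ι × α => (p.1, g p.1 p.2)) ↔ ∀ i, Function.Bijective (g i) := by
  constructor
  · refine fun h i => ⟨fun x y hxy => ?_, fun y => ?_⟩
    · exact congrArg Prod.snd (@h.1 (i, x) (i, y) (Prod.ext rfl hxy))
    · obtain ⟨⟨j, x⟩, hx⟩ := h.2 (i, y)
      obtain ⟨rfl, h2⟩ := Prod.mk.inj hx
      exact ⟨x, h2⟩
  · refine fun h => ⟨?_, ?_⟩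
    · rintro ⟨i, x⟩ ⟨j, y⟩ hxy
      obtain ⟨rfl, h2⟩ := Prod.mk.inj hxy
      exact Prod.ext rfl ((h i).1 h2)
    · rintro ⟨i, y⟩
      obtain ⟨x, hx⟩ := (h i).2 y
      exact ⟨(i, x), Prod.ext rfl hx⟩

/-- Up to translation by `b`, the map `n ↦ n + ω n` preserves every coset of the range of `M`, and
acts on the coset of `r i` as the map attached to the `i`-th component of `ω`. -/
theorem mem_Omega_image_iff {d : ℕ} {ι : Type*} (A : Finset (Fin d → ℤ))
    {M : (Fin d → ℤ) →+ (Fin d → ℤ)} {f : (Fin d → ℤ) → (Fin d → ℤ)} {b : Fin d → ℤ}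
    (hMb : ∀ x, f x = M x + b) (hf : Function.Injective f) {r : ι → Fin d → ℤ}
    (hr : Function.Bijective fun p : ι × (Fin d → ℤ) => r p.1 + M p.2)
    (ω : (Fin d → ℤ) → A.image f) :
    ω ∈ Omega (A.image f) ↔ ∀ i, cosetSplit A M hf hr ω i ∈ Omega A := by
  have hconj : (fun n : Fin d → ℤ => n + (ω n : Fin d → ℤ)) ∘ (Equiv.ofBijective _ hr) =
      (Equiv.addRight b) ∘ (Equiv.ofBijective _ hr) ∘
        fun p => (p.1, p.2 + (cosetSplit A M hf hr ω p.1 p.2 : Fin d → ℤ)) := by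
    funext p
    have h1 : (ω (r p.1 + M p.2) : Fin d → ℤ) =
        M (cosetSplit A M hf hr ω p.1 p.2 : Fin d → ℤ) + b := by
      rw [← hMb, ← imageEquiv_coe A f hf]
      simp [cosetSplit]
    simp only [Function.comp_apply, Equiv.ofBijective_apply, Equiv.coe_addRight, h1, map_add]
    abel
  change Function.Bijective _ ↔ ∀ i, Function.Bijective _
  rw [← bijective_prod_fiberwise_iff
      (fun i (q : Fin d → ℤ) => q + (cosetSplit A M hf hr ω i q : Fin d → ℤ)),
    ← Function.Bijective.of_comp_iff _ (Equiv.ofBijective _ hr).bijective, hconj,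
    Equiv.comp_bijective, Equiv.comp_bijective]

/-- The homeomorphism `Ω(f(A)) ≃ Ω(A)^ι` that splits a configuration along cosets. -/
noncomputable def OmegaImageHomeomorph {d : ℕ} {ι : Type*} (A : Finset (Fin d → ℤ))
    {M : (Fin d → ℤ) →+ (Fin d → ℤ)} {f : (Fin d → ℤ) → (Fin d → ℤ)} {b : Fin d → ℤ}
    (hMb : ∀ x, f x = M x + b) (hf : Function.Injective f) {r : ι → Fin d → ℤ}
    (hr : Function.Bijective fun p : ι × (Fin d → ℤ) => r p.1 + M p.2) :
    Omega (A.image f) ≃ₜ (ι → Omega A) where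
  toFun ω i := ⟨cosetSplit A M hf hr ω.1 i, (mem_Omega_image_iff A hMb hf hr ω.1).1 ω.2 i⟩
  invFun w := ⟨(cosetSplit A M hf hr).symm fun i => (w i).1, by
    rw [mem_Omega_image_iff A hMb hf hr, Equiv.apply_symm_apply]
    exact fun i => (w i).2⟩
  left_inv ω := Subtype.ext ((cosetSplit A M hf hr).symm_apply_apply ω.1)
  right_inv w := by
    funext i
    exact Subtype.ext (congrFun ((cosetSplit A M hf hr).apply_symm_apply fun i => (w i).1) i)
  continuous_toFun := by
    refine continuous_pi fun i => Continuous.subtype_mk (continuous_pi fun q => ?_) _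
    exact (continuous_of_discreteTopology (f := (imageEquiv A f hf).symm)).comp
      ((continuous_apply (r i + M q)).comp continuous_subtype_val)
  continuous_invFun := by
    refine Continuous.subtype_mk (continuous_pi fun x => ?_) _
    exact (continuous_of_discreteTopology (f := imageEquiv A f hf)).comp
      ((continuous_apply _).comp (continuous_subtype_val.comp (continuous_apply _)))

theorem patternCount_Omega_image {d : ℕ} {ι J : Type*} [Fintype ι] (A : Finset (Fin d → ℤ))
    {M : (Fin d → ℤ) →+ (Fin d → ℤ)} {f : (Fin d → ℤ) → (Fin d → ℤ)} {b : Fin d → ℤ}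
    (hMb : ∀ x, f x = M x + b) (hf : Function.Injective f) {r : ι → Fin d → ℤ}
    (hr : Function.Bijective fun p : ι × (Fin d → ℤ) => r p.1 + M p.2)
    (u : J → Fin d → ℤ) :
    patternCount (Omega (A.image f)) (fun p : ι × J => r p.1 + M (u p.2)) =
      patternCount (Omega A) u ^ Fintype.card ι := by
  rw [patternCount, patternCount, ← Nat.card_eq_fintype_card, ← Nat.card_fun]
  refine Nat.card_congr
    { toFun := fun P i => ⟨fun j => (imageEquiv A f hf).symm (P.1 (i, j)), ?_⟩
      invFun := fun w => ⟨fun p => imageEquiv A f hf ((w p.1).1 p.2), ?_⟩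
      left_inv := fun P => ?_
      right_inv := fun w => ?_ }
  · obtain ⟨ω, hω, h⟩ := P.2
    exact ⟨cosetSplit A M hf hr ω i, (mem_Omega_image_iff A hMb hf hr ω).1 hω i,
      fun j => congrArg (imageEquiv A f hf).symm (h (i, j))⟩
  · choose v hv hvw using fun i => (w i).2
    have hsplit := (cosetSplit A M hf hr).apply_symm_apply v
    refine ⟨(cosetSplit A M hf hr).symm v, ?_, fun p => ?_⟩
    · rw [mem_Omega_image_iff A hMb hf hr, hsplit]
      exact hv
    · dsimp only
      rw [← hvw p.1 p.2, ← Equiv.symm_apply_eq]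
      exact congrFun (congrFun hsplit p.1) (u p.2)
  · ext p
    simp
  · funext i
    ext j
    simp

theorem Omega_image_nonempty_iff {d : ℕ} {ι : Type*} [Nonempty ι] (A : Finset (Fin d → ℤ))
    {M : (Fin d → ℤ) →+ (Fin d → ℤ)} {f : (Fin d → ℤ) → (Fin d → ℤ)} {b : Fin d → ℤ}
    (hMb : ∀ x, f x = M x + b) (hf : Function.Injective f) {r : ι → Fin d → ℤ}
    (hr : Function.Bijective fun p : ι × (Fin d → ℤ) => r p.1 + M p.2) :
    (Omega (A.image f)).Nonempty ↔ (Omega A).Nonempty := by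
  rw [← Set.nonempty_coe_sort, ← Set.nonempty_coe_sort,
    (OmegaImageHomeomorph A hMb hf hr).toEquiv.nonempty_congr, Classical.nonempty_pi]
  exact forall_const ι

/-! ### Coset representatives -/

theorem finiteIndex_range {d : ℕ} {M : (Fin d → ℤ) →+ (Fin d → ℤ)}
    (hM : Function.Injective M) : M.range.FiniteIndex := by
  have hfin : Finite ((Fin d → ℤ) ⧸ LinearMap.range M.toIntLinearMap) :=
    Submodule.finiteQuotientOfFreeOfRankEq _ (LinearMap.finrank_range_of_inj hM)
  have : Finite ((Fin d → ℤ) ⧸ M.range) := hfin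
  exact AddSubgroup.finiteIndex_of_finite_quotient

theorem exists_representatives {d : ℕ} {M : (Fin d → ℤ) →+ (Fin d → ℤ)}
    (hM : Function.Injective M) :
    ∃ r : Fin M.range.index → Fin d → ℤ,
      Function.Bijective fun p : Fin M.range.index × (Fin d → ℤ) => r p.1 + M p.2 := by
  have := finiteIndex_range hM
  let e : Fin M.range.index ≃ (Fin d → ℤ) ⧸ M.range :=
    (Finite.equivFinOfCardEq (AddSubgroup.index_eq_card M.range).symm).symm
  have hmk : ∀ p : Fin M.range.index × (Fin d → ℤ),
      (((e p.1).out + M p.2 : Fin d → ℤ) : (Fin d → ℤ) ⧸ M.range) = e p.1 := fun p => by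
    rw [QuotientAddGroup.mk_add_of_mem _ (AddMonoidHom.mem_range.2 ⟨p.2, rfl⟩),
      QuotientAddGroup.out_eq']
  refine ⟨fun i => (e i).out, ?_, fun x => ?_⟩
  · rintro ⟨i, x⟩ ⟨j, y⟩ hxy
    have hij : i = j := by
      have := congrArg (QuotientAddGroup.mk (s := M.range)) hxy
      rw [hmk, hmk] at this
      exact e.injective this
    subst hij
    exact Prod.ext rfl (hM (add_left_cancel hxy))
  · have hx : ((e (e.symm x)).out : (Fin d → ℤ) ⧸ M.range) = x := by
      rw [QuotientAddGroup.out_eq', Equiv.apply_symm_apply]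
    obtain ⟨y, hy⟩ := QuotientAddGroup.eq.1 hx
    exact ⟨(e.symm x, y), by simp [hy]⟩

/-- Division with remainder in every coordinate: the translates of a box tile `ℤ^d`. -/
theorem bijective_mul_add_box {d : ℕ} {m : Fin d → ℕ} (hm : ∀ i, 0 < m i) :
    Function.Bijective fun p : (Fin d → ℤ) × box m => (fun i => (m i : ℤ) * p.1 i) + p.2.1 := by
  constructor
  · rintro ⟨t, q, hq⟩ ⟨t', q', hq'⟩ h
    rw [mem_box] at hq hq'
    have key : ∀ i, t i = t' i ∧ q i = q' i := fun i => by
      have hi : (m i : ℤ) * t i + q i = m i * t' i + q' i := congrFun h i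
      have hm' : (m i : ℤ) ≠ 0 := by exact_mod_cast (hm i).ne'
      have h1 : t i = t' i := by
        have := congrArg (· / (m i : ℤ)) hi
        rwa [add_comm, Int.add_mul_ediv_left _ _ hm', Int.ediv_eq_zero_of_lt (hq i).1 (hq i).2,
          add_comm _ (q' i), Int.add_mul_ediv_left _ _ hm',
          Int.ediv_eq_zero_of_lt (hq' i).1 (hq' i).2, zero_add, zero_add] at this
      refine ⟨h1, ?_⟩
      rw [h1] at hi
      exact add_left_cancel hi
    refine Prod.ext (funext fun i => (key i).1) (Subtype.ext (funext fun i => (key i).2))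
  · intro x
    have hm' : ∀ i, (0 : ℤ) < m i := fun i => by exact_mod_cast hm i
    refine ⟨(fun i => x i / m i, ⟨fun i => x i % m i, mem_box.2 fun i =>
      ⟨Int.emod_nonneg _ (hm' i).ne', Int.emod_lt_of_pos _ (hm' i)⟩⟩), ?_⟩
    funext i
    exact Int.mul_ediv_add_emod _ _

/-! ### Invariance of the entropy -/

theorem topEntropy_Omega_image_le {d : ℕ} (A : Finset (Fin d → ℤ))
    {M : (Fin d → ℤ) →+ (Fin d → ℤ)} (hM : Function.Injective M)
    {f : (Fin d → ℤ) → (Fin d → ℤ)} {b : Fin d → ℤ} (hMb : ∀ x, f x = M x + b) :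
    topEntropy (Omega (A.image f)) ≤ topEntropy (Omega A) := by
  have hf := injective_of_forall_eq_add hM hMb
  obtain ⟨r, hr⟩ := exists_representatives hM
  have := finiteIndex_range hM
  have hk : 0 < M.range.index := Nat.pos_of_ne_zero AddSubgroup.FiniteIndex.index_ne_zero
  have : Nonempty (Fin M.range.index) := ⟨⟨0, hk⟩⟩
  rcases (Omega (A.image f)).eq_empty_or_nonempty with hemp | hne
  · rw [topEntropy_eq_bot_of_empty hemp]
    exact bot_le
  have hneA := (Omega_image_nonempty_iff A hMb hf hr).1 hne
  rw [← limsup_const (f := (atTop : Filter (Fin d → ℕ))) (topEntropy (Omega (A.image f)))]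
  refine limsup_le_limsup ?_
  filter_upwards [eventually_forall_pos d] with m hm
  rw [entropy_ratio_eq_coe hneA]
  have : Nonempty (box m) := ⟨⟨0, mem_box.2 fun i => ⟨le_rfl, Int.natCast_pos.2 (hm i)⟩⟩⟩
  -- The tile is the union of the translates `r i + M [m]`, and it is moved by `M (m * ℤ^d)`.
  have hE : Function.Bijective fun p : (Fin d → ℤ) × (Fin M.range.index × box m) =>
      M (fun i => (m i : ℤ) * p.1 i) + (r p.2.1 + M p.2.2.1) := by
    have hcomp := hr.comp (((Equiv.refl (Fin M.range.index)).prodCongr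
      (Equiv.ofBijective _ (bijective_mul_add_box hm))).bijective.comp
      (show Function.Bijective fun p : (Fin d → ℤ) × (Fin M.range.index × box m) =>
        (p.2.1, (p.1, p.2.2)) from
        ⟨fun _ _ h => by
          simp only [Prod.mk.injEq] at h
          exact Prod.ext h.2.1 (Prod.ext h.1 h.2.2), fun p => ⟨(p.2.1, (p.1, p.2.2)), rfl⟩⟩))
    convert hcomp using 1
    funext p
    simp only [Function.comp_apply, Equiv.prodCongr_apply, Prod.map, Equiv.refl_apply,
      Equiv.ofBijective_apply, map_add]
    abel
  refine (topEntropy_le_of_tiling (shift_invariant_Omega _)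
    (s := fun p : Fin M.range.index × box m => r p.1 + M p.2.1)
    (h := fun t : Fin d → ℤ => M fun i => (m i : ℤ) * t i) hE).trans (le_of_eq ?_)
  rw [patternCount_Omega_image A hMb hf hr (Subtype.val : box m → Fin d → ℤ)]
  have hk' : (M.range.index : ℝ) ≠ 0 := by exact_mod_cast hk.ne'
  simp only [Fintype.card_prod, Fintype.card_fin, Fintype.card_coe, Nat.cast_pow, Real.log_pow,
    Nat.cast_mul]
  rw [mul_div_mul_left _ _ hk']

/-- For a homothety with ratio `c`, the box `[c n]` is exactly the union of the translates of
`c [n]` by the elements of `[c]^d`, so the entropy of `Ω(A)` is a limit superior along a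
subfamily of the boxes that define the entropy of `Ω(cA + b)`. -/
theorem topEntropy_Omega_le_homothety {d : ℕ} (A : Finset (Fin d → ℤ)) {c : ℕ} (hc : 0 < c)
    {f : (Fin d → ℤ) → (Fin d → ℤ)} {b : Fin d → ℤ} (hcb : ∀ x, f x = c • x + b) :
    topEntropy (Omega A) ≤ topEntropy (Omega (A.image f)) := by
  let M : (Fin d → ℤ) →+ (Fin d → ℤ) := nsmulAddMonoidHom c
  have hMb : ∀ x, f x = M x + b := hcb
  have hM : Function.Injective M := nsmul_right_injective hc.ne'
  have hf := injective_of_forall_eq_add hM hMb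
  have hr : Function.Bijective fun p : box (fun _ : Fin d => c) × (Fin d → ℤ) =>
      p.1.1 + M p.2 := by
    convert (bijective_mul_add_box (m := fun _ : Fin d => c) fun _ => hc).comp
      (Equiv.prodComm _ _).bijective using 1
    funext p i
    simp [M, add_comm]
  have : Nonempty (box fun _ : Fin d => c) :=
    ⟨⟨0, mem_box.2 fun i => ⟨le_rfl, Int.natCast_pos.2 hc⟩⟩⟩
  rcases (Omega A).eq_empty_or_nonempty with hemp | hneA
  · rw [topEntropy_eq_bot_of_empty hemp]
    exact bot_le
  have hne := (Omega_image_nonempty_iff A hMb hf hr).2 hneA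
  have hmap : Tendsto (fun n : Fin d → ℕ => c • n) atTop atTop :=
    tendsto_atTop_atTop.2 fun m => ⟨m, fun n hn i =>
      (hn i).trans (Nat.le_mul_of_pos_left (n i) hc)⟩
  refine le_trans ?_ (limsup_le_limsup_of_le hmap)
  rw [← limsup_comp]
  refine limsup_le_limsup (Eventually.of_forall fun n => ?_)
  simp only [Function.comp_apply]
  rw [entropy_ratio_eq_coe hneA, entropy_ratio_eq_coe hne, EReal.coe_le_coe_iff]
  have hcard : ((box (c • n)).card : ℝ) = (box fun _ : Fin d => c).card * (box n).card := by
    simp [card_box, Finset.prod_mul_distrib]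
  have hpow := patternCount_Omega_image A hMb hf hr (Subtype.val : box n → Fin d → ℤ)
  have hle := patternCount_le_pow (shift_invariant_Omega (A.image f))
    (Subtype.val : box (c • n) → Fin d → ℤ)
    (fun p : box (fun _ : Fin d => c) × box n => p.1.1 + M p.2.1)
    (fun _ : Unit => 0) fun p => by
      refine ⟨(), ⟨p.1.1 + M p.2.1, mem_box.2 fun i => ?_⟩, (zero_add _).symm⟩
      have h1 := mem_box.1 p.1.2 i
      have h2 := mem_box.1 p.2.2 i
      have hc' : (0 : ℤ) < c := by exact_mod_cast hc
      simp only [M, nsmulAddMonoidHom_apply, Pi.add_apply, Pi.smul_apply, smul_eq_mul,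
        Nat.cast_mul, nsmul_eq_mul, Pi.mul_apply, Pi.natCast_apply]
      constructor <;> nlinarith
  rw [hpow, Fintype.card_coe, Fintype.card_unit, pow_one] at hle
  have hq : ((box fun _ : Fin d => c).card : ℝ) ≠ 0 := by
    exact_mod_cast (Finset.card_pos.2 (Finset.nonempty_coe_sort.1 this)).ne'
  rw [hcard, ← mul_div_mul_left _ _ hq, ← Real.log_pow]
  gcongr
  · exact_mod_cast pow_pos (patternCount_pos hneA _) _
  · exact_mod_cast hle

/-- Multiplication by the index of its range factors through an injective endomorphism. -/
theorem exists_hom_comp_eq_index_nsmul {d : ℕ} {M : (Fin d → ℤ) →+ (Fin d → ℤ)}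
    (hM : Function.Injective M) :
    ∃ N : (Fin d → ℤ) →+ (Fin d → ℤ), Function.Injective N ∧
      ∀ x, N (M x) = M.range.index • x := by
  have := finiteIndex_range hM
  have hk : M.range.index ≠ 0 := AddSubgroup.FiniteIndex.index_ne_zero
  let N : (Fin d → ℤ) →+ (Fin d → ℤ) := (AddMonoidHom.ofInjective hM).symm.toAddMonoidHom.comp
    ((nsmulAddMonoidHom M.range.index).codRestrict M.range fun x => M.range.nsmul_index_mem x)
  have hN : ∀ y, M (N y) = M.range.index • y := fun y =>
    congrArg Subtype.val ((AddMonoidHom.ofInjective hM).apply_symm_apply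
      ⟨M.range.index • y, M.range.nsmul_index_mem y⟩)
  refine ⟨N, fun x y hxy => nsmul_right_injective hk ?_, fun x => hM ?_⟩
  · have := congrArg M hxy
    rwa [hN, hN] at this
  · rw [hN, map_nsmul]

theorem topEntropy_Omega_image {d : ℕ} (A : Finset (Fin d → ℤ))
    {M : (Fin d → ℤ) →+ (Fin d → ℤ)} (hM : Function.Injective M)
    {f : (Fin d → ℤ) → (Fin d → ℤ)} {b : Fin d → ℤ} (hMb : ∀ x, f x = M x + b) :
    topEntropy (Omega (A.image f)) = topEntropy (Omega A) := by
  refine le_antisymm (topEntropy_Omega_image_le A hM hMb) ?_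
  obtain ⟨N, hN, hNM⟩ := exists_hom_comp_eq_index_nsmul hM
  have := finiteIndex_range hM
  have hk : 0 < M.range.index := Nat.pos_of_ne_zero AddSubgroup.FiniteIndex.index_ne_zero
  have h1 : topEntropy (Omega A) ≤ topEntropy (Omega (A.image (N ∘ f))) :=
    topEntropy_Omega_le_homothety A hk (b := N b) fun x => by
      rw [Function.comp_apply, hMb, map_add, hNM]
  rw [← Finset.image_image] at h1
  exact h1.trans (topEntropy_Omega_image_le (A.image f) hN (b := 0) fun x => (add_zero _).symm)

end RestrictedPerm

theorem mainTheorem5 (d : ℕ) (A : Finset (Fin d → ℤ)) :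
    (∀ T : (Fin d → ℤ) →ᵃ[ℤ] (Fin d → ℤ), Function.Injective T →
      RestrictedPerm.topEntropy (RestrictedPerm.Omega (A.image T)) =
        RestrictedPerm.topEntropy (RestrictedPerm.Omega A)) ∧
    (∀ M : (Fin d → ℤ) →+ (Fin d → ℤ), Function.Injective M →
      M.range.FiniteIndex ∧
      ∃ Φ : RestrictedPerm.Omega (A.image M) ≃ₜ
          (Fin M.range.index → RestrictedPerm.Omega A),
        ∀ (n : Fin d → ℤ) (ω : RestrictedPerm.Omega (A.image M)) (i : Fin M.range.index),
          Φ (RestrictedPerm.shiftOmega (M n) ω) i =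
            RestrictedPerm.shiftOmega n (Φ ω i)) := by
  refine ⟨fun T hT => ?_, fun M hM => ⟨RestrictedPerm.finiteIndex_range hM, ?_⟩⟩
  · exact RestrictedPerm.topEntropy_Omega_image A (M := T.linear.toAddMonoidHom)
      (T.linear_injective_iff.2 hT) (b := T 0) fun x => congrFun T.decomp x
  · obtain ⟨r, hr⟩ := RestrictedPerm.exists_representatives hM
    refine ⟨RestrictedPerm.OmegaImageHomeomorph A (b := 0) (fun x => (add_zero _).symm) hM hr,
      fun n ω i => Subtype.ext (funext fun q => ?_)⟩
    change (RestrictedPerm.imageEquiv A M hM).symm (ω.1 (r i + M q + M n)) =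
      (RestrictedPerm.imageEquiv A M hM).symm (ω.1 (r i + M (q + n)))
    rw [map_add, add_assoc]
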